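/- **Setting.** An $\mathbb{R}$-tree is a metric space $X$ in which any two points $x,y$ are joined by exactly one geodesic path (with image $[x,y]$) and in which $[y,x]\cap[x,z]=\{x\}$ implies $[y,x]\cup[x,z]=[y,z]$. Fix a function $\mathsf{gth}:\mathbb{N}\times[0,1)\to\mathbb{N}$, increasing (in the weak sense) in the first argument, and functions $\gamma^{m,n}_G$ ($m<n$) of a positive real $\varepsilon$. A function $\gamma$ is a continuity modulus of $R$ in a given variable if $\gamma(\varepsilon)>0$ for all $\varepsilon>0$ and $d(a,a')<\gamma(\varepsilon)$ implies $|R(a)-R(a')|<\varepsilon$, the other variables being fixed. Write $a\dot-b=\max(a-b,0)$. Consider structures $M=(G,X,0,(\circ_{mn})_{m<n})$, where $G$ is a metric group, $X$ is a metric space with a distinguished point $0$, presented by the closed balls $B_n=\{x: d(0,x)\le n\}$ with inclusion maps, and $\circ_{mn}:G\times B_m\times B_m\to\mathbb{R}$. The class $\mathcal{K}_{iso\mathbb{R}}(\mathsf{gth},\gamma^{m,n}_G)$ consists of those $M$ such that: $G$ is complete, of bounded diameter, with bi-invariant metric; $X$ is a complete $\mathbb{R}$-tree; for $m<n$ the predicate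 $\circ_{mn}$ has values in $[0,m+n]$ and has the continuity modulus $\gamma^{m,n}_G$ in the $G$-variable and $\mathrm{id}$ in each $B_m$-variable; and the following hold for all $m<n$ (points $x,x_i,y,y_i,z,u$ range over $B_m$ unless indicated otherwise, $g,g'$ over $G$). * 1(a) $\sup_{g,x}\min(\circ_{ms}(g,x,0)\dot-k,\ \delta\dot-d(1,g))=0$ for $\delta\in[0,1)\cap\mathbb{Q}$, $\mathsf{gth}(m,\delta)\le k<s$, $m<s$. * 1(b) $\sup_{g}\sup_{x,y\in B_m}\min(|\circ_{ms}(g,x,y)-\circ_{m't}(g,x,y)|,\ \delta\dot-d(1,g))=0$ for $\delta\in[0,1)\cap\mathbb{Q}$, $m<m'$, $m<s<t$, $m'<t$, $\mathsf{gth}(m,\delta)<s$, $\mathsf{gth}(m',\delta)<t$. * 1(c) $\sup_{g,x}\min\big(m\dot-\circ_{mn}(g,x,0),\ \inf_z\max(\circ_{mn}(g,x,z),\sup_u\min(|d(u,z)-\circ_{mn}(g,x,u)|,\,m\dot-d(0,u)))\big)=0$. * 2(a) $\sup_{g,x,y_1,y_2}\min(d(y_1,y_2)\dot-(\circ_{mn}(g,x,y_1)+\circ_{mn}(g,x,y_2)),\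 m\dot-\circ_{mn}(g,x,0))=0$ and $\sup_{g,x,y_1,y_2}\min(\circ_{mn}(g,x,y_1)\dot-(d(y_1,y_2)+\circ_{mn}(g,x,y_2)),\ m\dot-\circ_{mn}(g,x,0))=0$. * 2(b) $\sup_{g,x_1,x_2}\min(\sup_y(d(x_1,x_2)\dot-(\circ_{mn}(g,x_1,y)+\circ_{mn}(g,x_2,y))),\ m\dot-\circ_{mn}(g,x_1,0),\ m\dot-\circ_{mn}(g,x_2,0))=0$. * 2(c) $\sup_{g,x_1,x_2}\min(\inf_y((\circ_{mn}(g,x_1,y)+\circ_{mn}(g,x_2,y))\dot-d(x_1,x_2)),\ m\dot-\circ_{mn}(g,x_1,0),\ m\dot-\circ_{mn}(g,x_2,0))=0$. * 3(a) $\sup_{x,y}|\circ_{mn}(1,x,y)-d(x,y)|=0$. * 3(b) $\sup_{g,x,y}\min(|\circ_{mn}(g,x,y)-\circ_{mn}(g^{-1},y,x)|,\ m\dot-\circ_{mn}(g,x,0),\ m\dot-\circ_{mn}(g^{-1},y,0))=0$. * 3(c) $\sup_{x,y,g,g'}\min(\sup_z(\circ_{mn}(gg',x,y)\dot-(\circ_{mn}(g^{-1},y,z)+\circ_{mn}(g',x,z))),\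 m\dot-\circ_{mn}(g^{-1},y,0),\ m\dot-\circ_{mn}(g',x,0),\ m\dot-\circ_{mn}(gg',x,0))=0$. For an isometric action of a metric group $G$ on a pointed $\mathbb{R}$-tree $(X,0)$, let $A(G,X)$ be the structure with $\circ_{mn}(g,x,y)=\mathrm{length}([gx,y]\cap B_n)$. The group $G$ has property non-$\mathbf{F}\mathbb{R}$ in $\mathcal{K}_{iso\mathbb{R}}(\mathsf{gth},\gamma^{m,n}_G)$ if it has an isometric action without fixed points on an $\mathbb{R}$-tree $X$ such that $A(G,X)$ is in this class for some $0\in X$; such structures $A(G,X)$ are said to witness the property. Let $\Theta_{s,m,n}$ be the condition $\sup_{v\in B_m}\inf_{g\in G}(\tfrac1s\dot-\circ_{mn}(g,v,v))=0$. **Theorem.** (a) There is a natural number $s\ge1$ such that every group with property non-$\mathbf{F}\mathbb{R}$ in $\mathcal{K}_{iso\mathbb{R}}(\mathsf{gth},\gamma^{m,n}_G)$ has an expansion to a structure $A(G,X)\in\mathcal{K}_{iso\mathbb{R}}(\mathsf{gth},\gamma^{m,n}_G)$, for some isometric action of $G$ on a pointed $\mathbb{R}$-tree $X$, that satisfies $\Theta_{s,m,n}$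 for all natural $m<n$. (b) The class of structures $A(G,X)$ witnessing property non-$\mathbf{F}\mathbb{R}$ in $\mathcal{K}_{iso\mathbb{R}}(\mathsf{gth},\gamma^{m,n}_G)$ is bountiful: for every $M=A(H,X)$ in this class and every infinite subset $C$ of $M$ (that is, of the disjoint union of $H$ and $X$) there are a subgroup $K\le H$ and a subset $Y\subseteq X$ with $0\in Y$ such that $C$ is contained in the disjoint union of $K$ and $Y$, the substructure of $M$ on $K$ and $Y$ belongs to the class, and the density character of the disjoint union of $K$ and $Y$ equals the density character of $C$. -/

import Mathlib

open Set

universe u v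

/-- Truncated subtraction of reals. -/
noncomputable def truncSub (a b : ℝ) : ℝ := max (a - b) 0

infixl:65 " ∸ " => truncSub

/-- `ρ` is a geodesic path joining `x` to `y`: an isometric map of the interval `[0, d(x,y)]` with
`ρ 0 = x` and `ρ (d(x,y)) = y`. -/
def IsGeodesicPath {X : Type v} [MetricSpace X] (x y : X)
    (ρ : Icc (0 : ℝ) (dist x y) → X) : Prop :=
  Isometry ρ ∧ ρ ⟨0, le_rfl, dist_nonneg⟩ = x ∧ ρ ⟨dist x y, dist_nonneg, le_rfl⟩ = y

def IsUniquelyGeodesic (X : Type v) [MetricSpace X] : Prop :=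
  ∀ x y : X, ∃! ρ : Icc (0 : ℝ) (dist x y) → X, IsGeodesicPath x y ρ

/-- The segment `[x, y]`. -/
def geodSegment {X : Type v} [MetricSpace X] (x y : X) : Set X :=
  {z | ∃ ρ : Icc (0 : ℝ) (dist x y) → X, IsGeodesicPath x y ρ ∧ z ∈ range ρ}

/-- Real trees: uniquely geodesic spaces where `[y,x] ∩ [x,z] = {x}` implies
`[y,x] ∪ [x,z] = [y,z]`. -/
def IsRTree (X : Type v) [MetricSpace X] : Prop :=
  IsUniquelyGeodesic X ∧ ∀ x y z : X, geodSegment y x ∩ geodSegment x z = {x} →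
    geodSegment y x ∪ geodSegment x z = geodSegment y z

/-- `length([x, y] ∩ S)`: the Lebesgue measure of the set of all `t` in `[0, d(x,y)]` such that
the (unique) geodesic path from `x` to `y`, parametrized by arc length, is in `S` at time `t`. -/
noncomputable def segLength {X : Type v} [MetricSpace X] (x y : X) (S : Set X) : ℝ :=
  (MeasureTheory.volume {t : ℝ | ∃ (ht : t ∈ Icc (0 : ℝ) (dist x y))
    (ρ : Icc (0 : ℝ) (dist x y) → X), IsGeodesicPath x y ρ ∧ ρ ⟨t, ht⟩ ∈ S}).toReal

/-- Structures in the language of actions on pointed trees: a group sort `G` with a metric, a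
pointed metric space `X` presented by the sorts `B n` (the closed `n`-balls of the base point,
see `IsoStructure.B`), and predicates `circ m n` on `G × B m × B m`. Only the predicates with
`m < n` belong to the language; nothing is ever required of the others. -/
structure IsoStructure where
  G : Type u
  [groupG : Group G]
  [metricG : MetricSpace G]
  X : Type v
  [metricX : MetricSpace X]
  base : X
  circ : ∀ m _n : ℕ, G → Metric.closedBall base (m : ℝ) → Metric.closedBall base (m : ℝ) → ℝ

namespace IsoStructure

attribute [instance] groupG metricG metricX

/-- The sort `B n`: the closed ball of radius `n` around the base point. -/
abbrev B (M : IsoStructure.{u, v}) (n : ℕ) : Set M.X := Metric.closedBall M.base (n : ℝ)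

/-- The base point as an element of the sort `B m`. -/
def zero (M : IsoStructure.{u, v}) (m : ℕ) : M.B m :=
  ⟨M.base, Metric.mem_closedBall_self (Nat.cast_nonneg m)⟩

/-- The inclusion map `B m → B m'`. -/
def incl (M : IsoStructure.{u, v}) {m m' : ℕ} (h : m ≤ m') : M.B m → M.B m' :=
  Set.inclusion (Metric.closedBall_subset_closedBall (Nat.cast_le.2 h))

/-- The structure `A(G, X)` of an action of `G` on the pointed space `(X, o)`: the predicate
`circ m n` is `length([g x, y] ∩ B n)`. -/
noncomputable def ofAction (G : Type u) [Group G] [MetricSpace G] (X : Type v) [MetricSpace X]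
    [MulAction G X] (o : X) : IsoStructure.{u, v} where
  G := G
  X := X
  base := o
  circ := fun _ n g x y => segLength (g • (x : X)) (y : X) (Metric.closedBall o (n : ℝ))

/-- The disjoint union of the group sort and of the space `X = ⋃ B n`. -/
abbrev Carrier (M : IsoStructure.{u, v}) : Type (max u v) := M.G ⊕ M.X

/-- The substructure of `M` formed by a subgroup `K` of `G` and a subset `Y` of `X` that contains
the base point; its sorts are `K` and the sets `Y ∩ B n`. -/
def restrict (M : IsoStructure.{u, v}) (K : Subgroup M.G) (Y : Set M.X) (hY : M.base ∈ Y) :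
    IsoStructure.{u, v} where
  G := K
  X := Y
  base := ⟨M.base, hY⟩
  circ := fun m n g x y =>
    M.circ m n (g : M.G) ⟨((x : Y) : M.X), x.2⟩ ⟨((y : Y) : M.X), y.2⟩

end IsoStructure

/-- `γ` is a continuity modulus of the real valued predicate `R` of one variable. -/
def HasModulus {A : Type*} [MetricSpace A] (γ : ℝ → ℝ) (R : A → ℝ) : Prop :=
  (∀ ε : ℝ, 0 < ε → 0 < γ ε) ∧
    ∀ ε : ℝ, 0 < ε → ∀ a a' : A, dist a a' < γ ε → |R a - R a'| < ε

/-- The class `K_isoℝ(gth, γ)`. The suprema and infima below are over bounded families,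
because of the fields `boundedSpace` and `circ_mem`. -/
structure KIsoR (gth : ℕ → Ico (0 : ℝ) 1 → ℕ) (γ : ℕ → ℕ → ℝ → ℝ)
    (M : IsoStructure.{u, v}) : Prop where
  /- The sort `G` is a complete metric group of bounded diameter with a bi-invariant metric. -/
  completeG : CompleteSpace M.G
  boundedSpace : BoundedSpace M.G
  dist_mul_left : ∀ h g g' : M.G, dist (h * g) (h * g') = dist g g'
  dist_mul_right : ∀ h g g' : M.G, dist (g * h) (g' * h) = dist g g'
  /- The sorts `B n` are the balls of a complete pointed real tree. -/
  completeX : CompleteSpace M.X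
  isRTree : IsRTree M.X
  /- Range and continuity moduli of the predicates. -/
  circ_mem : ∀ m n : ℕ, m < n → ∀ (g : M.G) (x y : M.B m),
    M.circ m n g x y ∈ Icc (0 : ℝ) ((m : ℝ) + n)
  modulus_G : ∀ m n : ℕ, m < n → ∀ x y : M.B m,
    HasModulus (γ m n) (fun g : M.G => M.circ m n g x y)
  modulus_left : ∀ m n : ℕ, m < n → ∀ (g : M.G) (y : M.B m),
    HasModulus id (fun x : M.B m => M.circ m n g x y)
  modulus_right : ∀ m n : ℕ, m < n → ∀ (g : M.G) (x : M.B m),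
    HasModulus id (fun y : M.B m => M.circ m n g x y)
  /- 1(a) The value `g x` is eventually defined inside some ball. -/
  ax1a : ∀ (m n s : ℕ) (δ : ℚ) (hδ : (δ : ℝ) ∈ Ico (0 : ℝ) 1), m < s →
    gth m ⟨δ, hδ⟩ ≤ n → n < s →
    (⨆ g : M.G, ⨆ x : M.B m,
      min (M.circ m s g x (M.zero m) ∸ n) ((δ : ℝ) ∸ dist 1 g)) = 0
  /- 1(b) Correctness. -/
  ax1b : ∀ (m m' s t : ℕ) (δ : ℚ) (hδ : (δ : ℝ) ∈ Ico (0 : ℝ) 1) (hm : m < m'),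
    m < s → m' < t → gth m ⟨δ, hδ⟩ < s → s < t → gth m' ⟨δ, hδ⟩ < t →
    (⨆ g : M.G, ⨆ x : M.B m, ⨆ y : M.B m,
      min |M.circ m s g x y - M.circ m' t g (M.incl hm.le x) (M.incl hm.le y)|
        ((δ : ℝ) ∸ dist 1 g)) = 0
  /- 1(c) Approximation of the value `g x`. -/
  ax1c : ∀ m n : ℕ, m < n →
    (⨆ g : M.G, ⨆ x : M.B m, min ((m : ℝ) ∸ M.circ m n g x (M.zero m))
      (⨅ z : M.B m, max (M.circ m n g x z)
        (⨆ w : M.B m, min |dist w z - M.circ m n g x w| ((m : ℝ) ∸ dist (M.zero m) w)))) = 0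
  /- 2(a) Triangle inequalities involving `g x`. -/
  ax2a : ∀ m n : ℕ, m < n →
    (⨆ g : M.G, ⨆ x : M.B m, ⨆ y₁ : M.B m, ⨆ y₂ : M.B m,
      min (dist y₁ y₂ ∸ (M.circ m n g x y₁ + M.circ m n g x y₂))
        ((m : ℝ) ∸ M.circ m n g x (M.zero m))) = 0
  ax2a' : ∀ m n : ℕ, m < n →
    (⨆ g : M.G, ⨆ x : M.B m, ⨆ y₁ : M.B m, ⨆ y₂ : M.B m,
      min (M.circ m n g x y₁ ∸ (dist y₁ y₂ + M.circ m n g x y₂))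
        ((m : ℝ) ∸ M.circ m n g x (M.zero m))) = 0
  /- 2(b) A triangle inequality for isometric actions. -/
  ax2b : ∀ m n : ℕ, m < n →
    (⨆ g : M.G, ⨆ x₁ : M.B m, ⨆ x₂ : M.B m,
      min (⨆ y : M.B m, dist x₁ x₂ ∸ (M.circ m n g x₁ y + M.circ m n g x₂ y))
        (min ((m : ℝ) ∸ M.circ m n g x₁ (M.zero m))
          ((m : ℝ) ∸ M.circ m n g x₂ (M.zero m)))) = 0
  /- 2(c) The action is isometric. -/
  ax2c : ∀ m n : ℕ, m < n →
    (⨆ g : M.G, ⨆ x₁ : M.B m, ⨆ x₂ : M.B m,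
      min (⨅ y : M.B m, (M.circ m n g x₁ y + M.circ m n g x₂ y) ∸ dist x₁ x₂)
        (min ((m : ℝ) ∸ M.circ m n g x₁ (M.zero m))
          ((m : ℝ) ∸ M.circ m n g x₂ (M.zero m)))) = 0
  /- 3(a) The neutral element acts trivially. -/
  ax3a : ∀ m n : ℕ, m < n →
    (⨆ x : M.B m, ⨆ y : M.B m, |M.circ m n 1 x y - dist x y|) = 0
  /- 3(b) The action of the inverse. -/
  ax3b : ∀ m n : ℕ, m < n →
    (⨆ g : M.G, ⨆ x : M.B m, ⨆ y : M.B m,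
      min |M.circ m n g x y - M.circ m n g⁻¹ y x|
        (min ((m : ℝ) ∸ M.circ m n g x (M.zero m))
          ((m : ℝ) ∸ M.circ m n g⁻¹ y (M.zero m)))) = 0
  /- 3(c) The action of products. -/
  ax3c : ∀ m n : ℕ, m < n →
    (⨆ x : M.B m, ⨆ y : M.B m, ⨆ g : M.G, ⨆ g' : M.G,
      min (⨆ z : M.B m, M.circ m n (g * g') x y ∸ (M.circ m n g⁻¹ y z + M.circ m n g' x z))
        (min ((m : ℝ) ∸ M.circ m n g⁻¹ y (M.zero m))
          (min ((m : ℝ) ∸ M.circ m n g' x (M.zero m))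
            ((m : ℝ) ∸ M.circ m n (g * g') x (M.zero m))))) = 0

/-- The condition `Θ_{s,m,n}`. -/
def Theta (s m n : ℕ) (M : IsoStructure.{u, v}) : Prop :=
  (⨆ w : M.B m, ⨅ g : M.G, ((1 : ℝ) / s) ∸ M.circ m n g w w) = 0

/-- The metric group `G` has property non-Fℝ in `K_isoℝ(gth, γ)`: it acts by isometries and
without fixed points on a tree `X` so that `A(G, X)` is in the class, for some base point. -/
def HasNonFR (gth : ℕ → Ico (0 : ℝ) 1 → ℕ) (γ : ℕ → ℕ → ℝ → ℝ)
    (G : Type u) [Group G] [MetricSpace G] : Prop :=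
  ∃ (X : Type v) (_ : MetricSpace X) (_ : MulAction G X) (o : X),
    IsIsometricSMul G X ∧ (∀ x : X, ∃ g : G, g • x ≠ x) ∧
      KIsoR gth γ (IsoStructure.ofAction G X o)

/-- The class of structures `A(G, X)` witnessing property non-Fℝ in `K_isoℝ(gth, γ)`: the
structure `M` is in the class, and it is `A(G, X)` for an isometric action without fixed
points. -/
def WitnessesNonFR (gth : ℕ → Ico (0 : ℝ) 1 → ℕ) (γ : ℕ → ℕ → ℝ → ℝ)
    (M : IsoStructure.{u, v}) : Prop :=
  ∃ _ : MulAction M.G M.X,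
    IsIsometricSMul M.G M.X ∧ (∀ x : M.X, ∃ g : M.G, g • x ≠ x) ∧
      (∀ m n : ℕ, m < n → ∀ (g : M.G) (x y : M.B m),
        M.circ m n g x y = segLength (g • (x : M.X)) (y : M.X) (M.B n)) ∧
      KIsoR gth γ M

/-- The density character of a set in a topological space: the smallest cardinality of a dense
subset of the set. -/
noncomputable def densityChar {α : Type*} [TopologicalSpace α] (S : Set α) : Cardinal :=
  sInf {c | ∃ T : Set α, T ⊆ S ∧ S ⊆ closure T ∧ Cardinal.mk T = c}

/-- A class of structures is bountiful if every infinite subset `C` of a member `M` is contained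
in a substructure of `M` that is a member of the class and has the density character of `C`. -/
def Bountiful (𝒞 : IsoStructure.{u, v} → Prop) : Prop :=
  ∀ M : IsoStructure.{u, v}, 𝒞 M → ∀ C : Set M.Carrier, C.Infinite →
    ∃ (K : Subgroup M.G) (Y : Set M.X) (hY : M.base ∈ Y),
      C ⊆ Sum.inl '' (K : Set M.G) ∪ Sum.inr '' Y ∧
      𝒞 (M.restrict K Y hY) ∧
      densityChar ((Sum.inl '' (K : Set M.G) ∪ Sum.inr '' Y : Set M.Carrier)) = densityChar C

/-! Everything rests on one fact: an isometric action on a complete real tree with a bounded orbit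
fixes the center of that orbit (`IsRTree.exists_fixedPoint`). Without fixed points, therefore, every
orbit is unbounded.

For (a), `s = 1` and the given action already suffice. Each `v` in `B m` has some `g` with `d(gv, v)
> 1`, and the last unit of `[gv, v]` stays within `m + 1 ≤ n` of the base point, so its length
inside `B n` is at least 1 (`min_le_segLength`).

For (b), take a dense `T ⊆ C` of least cardinality and elements `a n` moving the base point by more
than `n`. Generate a group by the `a n` and the group elements in `T`, and join the base point by
segments to the orbits of itself and of the points of `T`. The closures `K` and `Y` are a group and
an invariant subtree (`IsRTree.exists_closed_invariant`); words and rational times bound the density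
character. The `a n` prevent a fixed point of `K` in `Y`. Convexity of `Y` makes the restricted
predicates lengths again. Range, moduli and growth conditions are pointwise, hence inherited; the
other axioms, even those with infima, hold for every isometric action on a real tree
(`IsoStructure.IsAction.kIsoR`), since a nonzero guard forces `gx ∈ B m` and turns the predicate
into `d(gx, y)`. -/

/-! ### Metric betweenness, medians and fixed points in real trees. -/

section Tree

variable {X : Type v} [MetricSpace X]

/-- `z` lies metrically between `x` and `y`. -/
def Between (x z y : X) : Prop := dist x z + dist z y = dist x y

lemma Between.symm {x z y : X} (h : Between x z y) : Between y z x := by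
  unfold Between at *
  rw [dist_comm y z, dist_comm z x, dist_comm y x]; linarith

lemma between_left (x y : X) : Between x x y := by simp [Between]

lemma between_right (x y : X) : Between x y y := by simp [Between]

lemma Between.dist_le_left {x z y : X} (h : Between x z y) : dist x z ≤ dist x y := by
  unfold Between at h
  linarith [dist_nonneg (x := z) (y := y)]

/-- `Between` is transitive: if `w` is between `x` and `y`, and `z` is between `w` and `y`, then
`z` is between `x` and `y`. -/
lemma Between.trans {x w z y : X} (h : Between x w y) (h' : Between w z y) :
    Between x z y ∧ Between x w z := by
  unfold Between at *
  have h1 := dist_triangle x w z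
  have h2 := dist_triangle x z y
  constructor <;> linarith

lemma isClosed_between (x y : X) : IsClosed {z : X | Between x z y} :=
  isClosed_eq (by fun_prop) (by fun_prop)

/-- A parametrization by arc length of a geodesic path, extended to all reals. -/
def IsGeodesicMap (x y : X) (f : ℝ → X) : Prop :=
  f 0 = x ∧ f (dist x y) = y ∧
    ∀ s ∈ Icc 0 (dist x y), ∀ t ∈ Icc 0 (dist x y), dist (f s) (f t) = |s - t|

lemma IsGeodesicMap.isGeodesicPath {x y : X} {f : ℝ → X} (hf : IsGeodesicMap x y f) :
    IsGeodesicPath x y (fun t => f t) := by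
  refine ⟨Isometry.of_dist_eq fun s t => ?_, hf.1, hf.2.1⟩
  rw [hf.2.2 s s.2 t t.2, Subtype.dist_eq, Real.dist_eq]

lemma IsGeodesicPath.isGeodesicMap {x y : X} {ρ : Icc (0 : ℝ) (dist x y) → X}
    (h : IsGeodesicPath x y ρ) :
    IsGeodesicMap x y (fun t => ρ (projIcc 0 (dist x y) dist_nonneg t)) := by
  obtain ⟨h1, h2, h3⟩ := h
  refine ⟨?_, ?_, fun s hs t ht => ?_⟩
  · dsimp only
    rw [projIcc_left]; exact h2
  · dsimp only
    rw [projIcc_right]; exact h3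
  · dsimp only
    rw [projIcc_of_mem _ hs, projIcc_of_mem _ ht, h1.dist_eq, Subtype.dist_eq, Real.dist_eq]

lemma IsGeodesicMap.dist_left {x y : X} {f : ℝ → X} (hf : IsGeodesicMap x y f) {t : ℝ}
    (ht : t ∈ Icc 0 (dist x y)) : dist x (f t) = t := by
  have h := hf.2.2 0 ⟨le_rfl, dist_nonneg⟩ t ht
  rw [hf.1, zero_sub, abs_neg, abs_of_nonneg ht.1] at h
  exact h

lemma IsGeodesicMap.dist_right {x y : X} {f : ℝ → X} (hf : IsGeodesicMap x y f) {t : ℝ}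
    (ht : t ∈ Icc 0 (dist x y)) : dist (f t) y = dist x y - t := by
  have h := hf.2.2 t ht _ ⟨dist_nonneg, le_rfl⟩
  rw [hf.2.1, abs_sub_comm, abs_of_nonneg (by linarith [ht.2])] at h
  exact h

lemma IsGeodesicMap.between {x y : X} {f : ℝ → X} (hf : IsGeodesicMap x y f) {t : ℝ}
    (ht : t ∈ Icc 0 (dist x y)) : Between x (f t) y := by
  rw [Between, hf.dist_left ht, hf.dist_right ht]; ring

/-- Across the junction, going through `z` bounds the distance above; a shorter connection would
make `d(x, y)` smaller than `d(x, z) + d(z, y)`. -/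
lemma IsGeodesicMap.concat {x z y : X} {f g : ℝ → X} (hf : IsGeodesicMap x z f)
    (hg : IsGeodesicMap z y g) (h : Between x z y) :
    IsGeodesicMap x y (fun t => if t ≤ dist x z then f t else g (t - dist x z)) := by
  have h0 : 0 ≤ dist x z := dist_nonneg
  have h0' : 0 ≤ dist z y := dist_nonneg
  unfold Between at h
  have cross : ∀ s ∈ Icc 0 (dist x y), ∀ t ∈ Icc 0 (dist x y), s ≤ dist x z → dist x z < t →
      dist (f s) (g (t - dist x z)) = t - s := by
    intro s hs t ht hsz hzt
    have hs' : s ∈ Icc 0 (dist x z) := ⟨hs.1, hsz⟩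
    have ht' : t - dist x z ∈ Icc 0 (dist z y) := ⟨by linarith, by linarith [ht.2]⟩
    have a1 := hf.dist_left hs'
    have a2 := hf.dist_right hs'
    have a3 := hg.dist_left ht'
    have a4 := hg.dist_right ht'
    have t1 := dist_triangle (f s) z (g (t - dist x z))
    have t2 := dist_triangle x (f s) y
    have t3 := dist_triangle (f s) (g (t - dist x z)) y
    apply le_antisymm <;> linarith
  refine ⟨by simp only [h0, if_true]; exact hf.1, ?_, ?_⟩
  · dsimp only
    split_ifs with hle
    · have : dist z y = 0 := by linarith
      rw [dist_eq_zero] at this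
      subst this
      exact hf.2.1
    · rw [show dist x y - dist x z = dist z y by linarith]
      exact hg.2.1
  · intro s hs t ht
    dsimp only
    split_ifs with h1 h2 h2
    · exact hf.2.2 s ⟨hs.1, h1⟩ t ⟨ht.1, h2⟩
    · rw [cross s hs t ht h1 (not_le.1 h2), abs_sub_comm, abs_of_nonneg (by linarith)]
    · rw [dist_comm, cross t ht s hs h2 (not_le.1 h1), abs_of_nonneg (by linarith)]
    · rw [hg.2.2 _ ⟨by linarith, by linarith [hs.2]⟩ _ ⟨by linarith, by linarith [ht.2]⟩]
      congr 1; ring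

lemma IsUniquelyGeodesic.exists_map (hX : IsUniquelyGeodesic X) (x y : X) :
    ∃ f : ℝ → X, IsGeodesicMap x y f := by
  obtain ⟨ρ, hρ, -⟩ := hX x y
  exact ⟨_, hρ.isGeodesicMap⟩

lemma IsUniquelyGeodesic.exists_map_through (hX : IsUniquelyGeodesic X) {x z y : X}
    (h : Between x z y) : ∃ f : ℝ → X, IsGeodesicMap x y f ∧ f (dist x z) = z := by
  obtain ⟨f, hf⟩ := hX.exists_map x z
  obtain ⟨g, hg⟩ := hX.exists_map z y
  exact ⟨_, hf.concat hg h, by simpa using hf.2.1⟩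

lemma IsUniquelyGeodesic.map_unique (hX : IsUniquelyGeodesic X) {x y : X} {f g : ℝ → X}
    (hf : IsGeodesicMap x y f) (hg : IsGeodesicMap x y g) {t : ℝ} (ht : t ∈ Icc 0 (dist x y)) :
    f t = g t :=
  congrFun ((hX x y).unique hf.isGeodesicPath hg.isGeodesicPath) ⟨t, ht⟩

lemma IsUniquelyGeodesic.eq_map_of_between (hX : IsUniquelyGeodesic X) {x z y : X} {f : ℝ → X}
    (hf : IsGeodesicMap x y f) (h : Between x z y) : f (dist x z) = z := by
  obtain ⟨g, hg, hgz⟩ := hX.exists_map_through h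
  rw [← hgz, hgz, hX.map_unique hf hg ⟨dist_nonneg, h.dist_le_left⟩, hgz]

/-- This dictionary replaces paths by equations between distances, so that later arguments reduce to
linear arithmetic. -/
lemma mem_geodSegment (hX : IsUniquelyGeodesic X) {x y z : X} :
    z ∈ geodSegment x y ↔ Between x z y := by
  constructor
  · rintro ⟨ρ, hρ, t, rfl⟩
    have := hρ.isGeodesicMap.between t.2
    rwa [projIcc_val] at this
  · intro h
    obtain ⟨f, hf, hz⟩ := hX.exists_map_through h
    exact ⟨_, hf.isGeodesicPath, ⟨dist x z, dist_nonneg, h.dist_le_left⟩, hz⟩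

lemma setOf_between_eq_image (hX : IsUniquelyGeodesic X) {x y : X} {f : ℝ → X}
    (hf : IsGeodesicMap x y f) : {z | Between x z y} = f '' Icc 0 (dist x y) := by
  ext z
  constructor
  · intro h
    exact ⟨dist x z, ⟨dist_nonneg, Between.dist_le_left h⟩, hX.eq_map_of_between hf h⟩
  · rintro ⟨t, ht, rfl⟩
    exact hf.between ht

lemma IsGeodesicMap.continuousOn {x y : X} {f : ℝ → X} (hf : IsGeodesicMap x y f) :
    ContinuousOn f (Icc 0 (dist x y)) := by
  rw [continuousOn_iff_continuous_domRestrict]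
  exact hf.isGeodesicPath.1.continuous

lemma isCompact_between (hX : IsUniquelyGeodesic X) (x y : X) :
    IsCompact {z | Between x z y} := by
  obtain ⟨f, hf⟩ := hX.exists_map x y
  rw [setOf_between_eq_image hX hf]
  exact isCompact_Icc.image_of_continuousOn hf.continuousOn

/-- In a real tree, the three sides of a triangle have a common point. -/
lemma IsRTree.exists_median (hX : IsRTree X) (x y z : X) :
    ∃ w, Between z w x ∧ Between z w y ∧ Between x w y := by
  -- The branch point: the common point of `[z, x]` and `[z, y]` farthest from `z`.
  obtain ⟨w, ⟨hwx, hwy⟩, hw⟩ := ((isCompact_between hX.1 z x).inter_right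
    (isClosed_between z y)).exists_isMaxOn ⟨z, between_left z x, between_left z y⟩
    (f := fun w => dist z w) (by fun_prop)
  refine ⟨w, hwx, hwy, ?_⟩
  -- A point of both segments beyond `w` would be a common point farther from `z`. The tree axiom
  -- then glues `[x, w]` and `[w, y]` to `[x, y]`.
  have key : geodSegment x w ∩ geodSegment w y = {w} := by
    ext p
    simp only [mem_inter_iff, mem_geodSegment hX.1, mem_singleton_iff]
    constructor
    · rintro ⟨h1, h2⟩
      obtain ⟨h3, h4⟩ := Between.trans hwx h1.symm
      obtain ⟨h5, -⟩ := Between.trans hwy h2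
      have h6 : dist z p ≤ dist z w := hw ⟨h3, h5⟩
      unfold Between at h4
      have h7 : dist w p = 0 := le_antisymm (by linarith) dist_nonneg
      exact (dist_eq_zero.1 h7).symm
    · rintro rfl
      exact ⟨between_right _ _, between_left _ _⟩
  have := hX.2 w x y key
  rw [← mem_geodSegment hX.1, ← this]
  exact Or.inl ((mem_geodSegment hX.1).2 (between_right _ _))

/-- Triangles in a real tree are tripods: each side is covered by the other two. -/
lemma IsRTree.between_or_between (hX : IsRTree X) {x y p : X} (h : Between x p y) (z : X) :
    Between x p z ∨ Between z p y := by
  obtain ⟨w, h1, h2, h3⟩ := hX.exists_median x y z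
  obtain ⟨f, hf⟩ := hX.1.exists_map x y
  have hp := hX.1.eq_map_of_between hf h
  have hw := hX.1.eq_map_of_between hf h3
  have hpI : dist x p ∈ Icc 0 (dist x y) := ⟨dist_nonneg, h.dist_le_left⟩
  have hwI : dist x w ∈ Icc 0 (dist x y) := ⟨dist_nonneg, h3.dist_le_left⟩
  have hd := hf.2.2 _ hpI _ hwI
  rw [hp, hw] at hd
  unfold Between at *
  have t1 := dist_triangle x p z
  have t2 := dist_triangle p w z
  have t3 := dist_triangle z p y
  have t4 := dist_triangle z w p
  have c1 := dist_comm z w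
  have c2 := dist_comm w x
  have c3 := dist_comm z x
  have c4 := dist_comm w p
  rcases le_total (dist x p) (dist x w) with hle | hle
  · left
    rw [abs_of_nonpos (by linarith)] at hd
    linarith
  · right
    rw [abs_of_nonneg (by linarith)] at hd
    linarith

lemma IsRTree.exists_midpoint (hX : IsRTree X) (x y : X) :
    ∃ m, dist x m = dist x y / 2 ∧ Between x m y := by
  obtain ⟨f, hf⟩ := hX.1.exists_map x y
  have h : dist x y / 2 ∈ Icc 0 (dist x y) := by
    constructor <;> linarith [dist_nonneg (x := x) (y := y)]
  exact ⟨f (dist x y / 2), hf.dist_left h, hf.between h⟩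

/-- Closed balls in a real tree are convex. -/
lemma IsRTree.between_mem_closedBall (hX : IsRTree X) {o x y z : X} {r : ℝ}
    (hx : x ∈ Metric.closedBall o r) (hy : y ∈ Metric.closedBall o r) (h : Between x z y) :
    z ∈ Metric.closedBall o r := by
  rw [Metric.mem_closedBall'] at *
  rcases hX.between_or_between h o with h' | h'
  · exact h'.symm.dist_le_left.trans hx
  · exact h'.dist_le_left.trans hy

/-- A bounded orbit of an isometric action on a complete real tree yields a fixed point, the
center of the orbit. -/
theorem IsRTree.exists_fixedPoint [CompleteSpace X] (hX : IsRTree X) {G : Type u} [Group G]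
    [MulAction G X] [IsIsometricSMul G X] (v : X) (R : ℝ) (hR : ∀ g : G, dist (g • v) v ≤ R) :
    ∃ c : X, ∀ g : G, g • c = c := by
  -- The least radius of a closed ball around `x` containing the orbit; it is invariant, and the
  -- center is its unique minimizer.
  set r : X → ℝ := fun x => ⨆ g : G, dist x (g • v) with hr
  have bdd : ∀ x, BddAbove (range fun g : G => dist x (g • v)) := by
    intro x
    refine ⟨dist x v + R, ?_⟩
    rintro _ ⟨g, rfl⟩
    have h1 := dist_triangle x v (g • v)
    have h2 := hR g
    rw [dist_comm v] at h1
    linarith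
  have le_r : ∀ x (g : G), dist x (g • v) ≤ r x := fun x g => le_ciSup (bdd x) g
  have r_nonneg : ∀ x, 0 ≤ r x := fun x => dist_nonneg.trans (le_r x 1)
  have r_lip : ∀ x y, r x ≤ dist x y + r y := fun x y =>
    ciSup_le fun g => (dist_triangle x y (g • v)).trans (by linarith [le_r y g])
  have r_inv : ∀ (h : G) x, r (h • x) = r x := by
    have aux : ∀ (h : G) x, r (h • x) ≤ r x := by
      intro h x
      refine ciSup_le fun g => ?_
      have := le_r x (h⁻¹ * g)
      rw [mul_smul] at this
      rwa [← dist_smul h, smul_inv_smul] at this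
    intro h x
    refine le_antisymm (aux h x) ?_
    have := aux h⁻¹ (h • x)
    rwa [inv_smul_smul] at this
  have bddr : BddBelow (range r) := ⟨0, by rintro _ ⟨x, rfl⟩; exact r_nonneg x⟩
  have : Nonempty X := ⟨v⟩
  set ρ := ⨅ x, r x with hρ
  have ρ_le : ∀ x, ρ ≤ r x := fun x => ciInf_le bddr x
  -- The midpoint of `[x, y]` lies on the way from `x` or from `y` to any given orbit point, hence
  -- is closer to it by `d(x, y) / 2`. So almost minimizers are close together.
  have key : ∀ x y ε, r x ≤ ρ + ε → r y ≤ ρ + ε → dist x y ≤ 2 * ε := by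
    intro x y ε hx hy
    obtain ⟨m, hm, hb⟩ := hX.exists_midpoint x y
    have hm' : dist m y = dist x y / 2 := by unfold Between at hb; linarith
    have : r m ≤ ρ + ε - dist x y / 2 := by
      refine ciSup_le fun g => ?_
      rcases hX.between_or_between hb (g • v) with h | h
      · have := le_r x g
        unfold Between at h
        linarith
      · have := le_r y g
        unfold Between at h
        linarith [dist_comm (g • v) m, dist_comm (g • v) y, dist_comm m y]
    linarith [ρ_le m]
  have ex : ∀ k : ℕ, ∃ x, r x < ρ + 1 / ((k : ℝ) + 1) := fun k =>
    exists_lt_of_ciInf_lt (lt_add_of_pos_right _ (by positivity))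
  choose x hx using ex
  have hC : CauchySeq x := by
    refine cauchySeq_of_le_tendsto_0 (fun k : ℕ => 2 * (1 / ((k : ℝ) + 1))) ?_ ?_
    · intro n m N hn hm
      have aux : ∀ n, N ≤ n → r (x n) ≤ ρ + 1 / ((N : ℝ) + 1) := fun n hn =>
        (hx n).le.trans (by gcongr)
      exact key _ _ _ (aux n hn) (aux m hm)
    · simpa using (tendsto_one_div_add_atTop_nhds_zero_nat (𝕜 := ℝ)).const_mul 2
  obtain ⟨c, hc⟩ := cauchySeq_tendsto_of_complete hC
  have hrc : r c ≤ ρ := by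
    have h1 : Filter.Tendsto (fun k => dist c (x k) + (ρ + 1 / ((k : ℝ) + 1))) Filter.atTop
        (nhds (dist c c + (ρ + 0))) :=
      (tendsto_const_nhds.dist hc).add
        (tendsto_const_nhds.add tendsto_one_div_add_atTop_nhds_zero_nat)
    have := ge_of_tendsto' h1 fun k => (r_lip c (x k)).trans (by linarith [(hx k).le])
    simpa using this
  refine ⟨c, fun g => ?_⟩
  -- With `ε = 0`, `key` says that minimizers are unique.
  have := key (g • c) c 0 (by rw [r_inv]; linarith) (by linarith)
  exact dist_le_zero.1 (by linarith)

lemma IsRTree.exists_lt_dist_smul [CompleteSpace X] (hX : IsRTree X) {G : Type u} [Group G]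
    [MulAction G X] [IsIsometricSMul G X] (hfix : ∀ x : X, ∃ g : G, g • x ≠ x) (v : X) (R : ℝ) :
    ∃ g : G, R < dist (g • v) v := by
  by_contra! h
  obtain ⟨c, hc⟩ := hX.exists_fixedPoint v R h
  obtain ⟨g, hg⟩ := hfix c
  exact hg (hc g)

end Tree

/-! ### Lengths of segments inside balls. -/

section SegLength

variable {X : Type v} [MetricSpace X]

/-- A point of the segment is met at the time equal to its distance from `x`, so the path can be
eliminated. -/
lemma segLength_eq (hX : IsUniquelyGeodesic X) (x y : X) (S : Set X) :
    segLength x y S = (MeasureTheory.volume {t : ℝ | ∃ z ∈ S, dist x z = t ∧ Between x z y}).toReal := by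
  unfold segLength
  congr 2
  ext t
  constructor
  · rintro ⟨ht, ρ, hρ, h⟩
    have h1 := hρ.isGeodesicMap.between ht
    have h2 := hρ.isGeodesicMap.dist_left ht
    rw [projIcc_of_mem _ ht] at h1 h2
    exact ⟨_, h, h2, h1⟩
  · rintro ⟨z, hz, rfl, h⟩
    obtain ⟨f, hf, hfz⟩ := hX.exists_map_through h
    refine ⟨⟨dist_nonneg, h.dist_le_left⟩, _, hf.isGeodesicPath, ?_⟩
    dsimp only
    rwa [hfz]

/-- A final part of length `min (d x y) b` of `[x, y]` is contained in a ball whose radius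
exceeds by `b` the distance of `y` from the center. -/
lemma min_le_segLength (hX : IsUniquelyGeodesic X) {x y o : X} {a b r : ℝ} (hb : 0 ≤ b)
    (hy : dist y o ≤ a) (hr : a + b ≤ r) :
    min (dist x y) b ≤ segLength x y (Metric.closedBall o r) := by
  obtain ⟨f, hf⟩ := hX.exists_map x y
  have hd : 0 ≤ dist x y := dist_nonneg
  rw [segLength_eq hX]
  have hsub : Icc (dist x y - min (dist x y) b) (dist x y) ⊆
      {t : ℝ | ∃ z ∈ Metric.closedBall o r, dist x z = t ∧ Between x z y} := by
    intro t ht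
    have ht' : t ∈ Icc 0 (dist x y) :=
      ⟨by linarith [ht.1, min_le_left (dist x y) b], ht.2⟩
    refine ⟨f t, ?_, hf.dist_left ht', hf.between ht'⟩
    have h1 := hf.dist_right ht'
    have h2 := dist_triangle (f t) y o
    rw [Metric.mem_closedBall]
    linarith [ht.1, min_le_right (dist x y) b]
  -- Needed because `toReal` sends an infinite measure to 0.
  have hfin : MeasureTheory.volume
      {t : ℝ | ∃ z ∈ Metric.closedBall o r, dist x z = t ∧ Between x z y} ≠ ⊤ := by
    refine ne_top_of_le_ne_top (b := MeasureTheory.volume (Icc 0 (dist x y))) (by simp)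
      (MeasureTheory.measure_mono ?_)
    rintro t ⟨z, -, rfl, h⟩
    exact ⟨dist_nonneg, h.dist_le_left⟩
  have := ENNReal.toReal_mono hfin (MeasureTheory.measure_mono hsub)
  rw [Real.volume_Icc, ENNReal.toReal_ofReal] at this
  · linarith
  · have := le_min hd hb
    linarith

lemma segLength_nonneg (x y : X) (S : Set X) : 0 ≤ segLength x y S := ENNReal.toReal_nonneg

lemma segLength_eq_dist (hX : IsRTree X) {x y o : X} {r : ℝ}
    (hx : x ∈ Metric.closedBall o r) (hy : y ∈ Metric.closedBall o r) :
    segLength x y (Metric.closedBall o r) = dist x y := by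
  rw [segLength_eq hX.1]
  have : {t : ℝ | ∃ z ∈ Metric.closedBall o r, dist x z = t ∧ Between x z y} =
      Icc 0 (dist x y) := by
    obtain ⟨f, hf⟩ := hX.1.exists_map x y
    ext t
    constructor
    · rintro ⟨z, -, rfl, h⟩
      exact ⟨dist_nonneg, h.dist_le_left⟩
    · intro ht
      exact ⟨f t, hX.between_mem_closedBall hx hy (hf.between ht), hf.dist_left ht,
        hf.between ht⟩
  rw [this, Real.volume_Icc, ENNReal.toReal_ofReal (by linarith [dist_nonneg (x := x) (y := y)])]
  ring

end SegLength

/-! ### Convex subsets of real trees. -/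

section Convex

variable {X : Type v} [MetricSpace X]

/-- `Y` contains the segment joining any two of its points. -/
def GeodConvex (Y : Set X) : Prop :=
  ∀ x ∈ Y, ∀ y ∈ Y, ∀ z, Between x z y → z ∈ Y

lemma GeodConvex.isUniquelyGeodesic {Y : Set X} (hY : GeodConvex Y) (hX : IsUniquelyGeodesic X) :
    IsUniquelyGeodesic Y := by
  intro x y
  obtain ⟨f, hf⟩ := hX.exists_map (x : X) y
  have hp := hf.isGeodesicPath
  refine ⟨fun t => ⟨f t, hY x x.2 y y.2 _ (hf.between t.2)⟩, ⟨?_, ?_, ?_⟩, ?_⟩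
  · exact Isometry.of_dist_eq fun s t => hp.1.dist_eq s t
  · exact Subtype.ext hp.2.1
  · exact Subtype.ext hp.2.2
  · rintro σ ⟨h1, h2, h3⟩
    have hσ : IsGeodesicPath (x : X) y (fun t => (σ t : X)) :=
      ⟨Isometry.of_dist_eq fun s t => h1.dist_eq s t, congrArg Subtype.val h2,
        congrArg Subtype.val h3⟩
    funext t
    exact Subtype.ext (congrFun ((hX x y).unique hσ hp) t)

lemma GeodConvex.isRTree {Y : Set X} (hY : GeodConvex Y) (hX : IsRTree X) : IsRTree Y := by
  have hU := hY.isUniquelyGeodesic hX.1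
  refine ⟨hU, fun x y z h => ?_⟩
  have h' : geodSegment (y : X) x ∩ geodSegment (x : X) z = {(x : X)} := by
    ext p
    simp only [mem_inter_iff, mem_geodSegment hX.1, mem_singleton_iff]
    constructor
    · rintro ⟨h1, h2⟩
      have hp := hY y y.2 x x.2 p h1
      have : (⟨p, hp⟩ : Y) ∈ geodSegment y x ∩ geodSegment x z :=
        ⟨(mem_geodSegment hU).2 h1, (mem_geodSegment hU).2 h2⟩
      rw [h] at this
      exact congrArg Subtype.val this
    · rintro rfl
      exact ⟨between_right _ _, between_left _ _⟩
  have h2 := hX.2 (x : X) y z h'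
  ext p
  have h3 := Set.ext_iff.1 h2 (p : X)
  simp only [mem_union, mem_geodSegment hX.1] at h3
  simp only [mem_union, mem_geodSegment hU]
  exact h3

lemma GeodConvex.segLength_coe {Y : Set X} (hY : GeodConvex Y) (hX : IsUniquelyGeodesic X)
    (x y : Y) (S : Set X) : segLength x y ((↑) ⁻¹' S : Set Y) = segLength (x : X) y S := by
  rw [segLength_eq hX, segLength_eq (hY.isUniquelyGeodesic hX)]
  congr 2
  ext t
  constructor
  · rintro ⟨z, hz, h1, h2⟩
    exact ⟨z, hz, h1, h2⟩
  · rintro ⟨z, hz, h1, h2⟩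
    exact ⟨⟨z, hY x x.2 y y.2 z h2⟩, hz, h1, h2⟩

/-- Replace the endpoints by nearby points `x'`, `y'` of `Y`, using the tripod property twice:
either `z` is on the short segment `[x, x']` or `[y, y']`, hence near `Y`, or it is on `[x', y']`.
-/
lemma GeodConvex.closure {Y : Set X} (hY : GeodConvex Y) (hX : IsRTree X) :
    GeodConvex (closure Y) := by
  intro x hx y hy z hz
  rw [Metric.mem_closure_iff] at *
  intro ε hε
  obtain ⟨x', hx', hxx⟩ := hx ε hε
  obtain ⟨y', hy', hyy⟩ := hy ε hε
  rcases hX.between_or_between hz x' with h | h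
  · refine ⟨x', hx', ?_⟩
    have := h.symm.dist_le_left
    rw [dist_comm z, dist_comm x] at *
    linarith
  · rcases hX.between_or_between h y' with h | h
    · exact ⟨z, hY _ hx' _ hy' _ h, by simpa using hε⟩
    · refine ⟨y', hy', ?_⟩
      have := h.dist_le_left
      rw [dist_comm z, dist_comm y] at *
      linarith

/-- A union of segments starting at a common point of a real tree is convex. -/
lemma IsRTree.geodConvex_iUnion (hX : IsRTree X) {ι : Sort*} (o : X) (p : ι → X) :
    GeodConvex (⋃ i, {z | Between o z (p i)}) := by
  intro x hx y hy z hz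
  simp only [mem_iUnion, mem_ofPred_eq] at *
  obtain ⟨i, hi⟩ := hx
  obtain ⟨j, hj⟩ := hy
  rcases hX.between_or_between hz o with h | h
  · exact ⟨i, (hi.symm.trans h).1.symm⟩
  · exact ⟨j, (hj.symm.trans h.symm).1.symm⟩

end Convex

/-! ### Density characters. -/

section Density

variable {α : Type u} [TopologicalSpace α]

lemma densityChar_le {S T : Set α} (h1 : T ⊆ S) (h2 : S ⊆ closure T) :
    densityChar S ≤ Cardinal.mk T :=
  csInf_le' ⟨T, h1, h2, rfl⟩

lemma exists_mk_eq_densityChar (S : Set α) :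
    ∃ T ⊆ S, S ⊆ closure T ∧ Cardinal.mk T = densityChar S := by
  have : densityChar S ∈ {c | ∃ T : Set α, T ⊆ S ∧ S ⊆ closure T ∧ Cardinal.mk T = c} :=
    csInf_mem ⟨_, S, Subset.rfl, subset_closure, rfl⟩
  exact this

lemma Set.Infinite.of_subset_closure [T1Space α] {S T : Set α} (hS : S.Infinite)
    (h : S ⊆ closure T) : T.Infinite := by
  intro hT
  rw [hT.isClosed.closure_eq] at h
  exact hS (hT.subset h)

/-- The density character is monotone on subsets of a metrizable space. -/
lemma densityChar_mono [TopologicalSpace.MetrizableSpace α] {C D : Set α} (hC : C.Infinite)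
    (h : C ⊆ D) : densityChar C ≤ densityChar D := by
  let _ := TopologicalSpace.metrizableSpaceMetric α
  obtain ⟨T, -, hDT, hT⟩ := exists_mk_eq_densityChar D
  have hTinf : T.Infinite := hC.of_subset_closure (h.trans hDT)
  have hTc : Cardinal.aleph0 ≤ Cardinal.mk T :=
    Cardinal.aleph0_le_mk_iff.2 hTinf.to_subtype
  obtain ⟨c₀, hc₀⟩ := hC.nonempty
  -- `T` need not meet `C`, so each ball of radius `1 / (n + 1)` around a point of `T` contributes a
  -- point of `C` if it has one, and the default `c₀` otherwise.
  have ex : ∀ p : T × ℕ, ∃ c ∈ C, (∃ c' ∈ C, dist c' p.1 < 1 / ((p.2 : ℝ) + 1)) →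
      dist c p.1 < 1 / ((p.2 : ℝ) + 1) := by
    intro p
    by_cases hp : ∃ c' ∈ C, dist c' p.1 < 1 / ((p.2 : ℝ) + 1)
    · obtain ⟨c, hc, hd⟩ := hp
      exact ⟨c, hc, fun _ => hd⟩
    · exact ⟨c₀, hc₀, fun h => absurd h hp⟩
  choose f hfC hf using ex
  have hdense : C ⊆ closure (range f) := by
    intro c hc
    rw [Metric.mem_closure_iff]
    intro ε hε
    obtain ⟨n, hn⟩ := exists_nat_one_div_lt (half_pos hε)
    obtain ⟨t, ht, hct⟩ := Metric.mem_closure_iff.1 (hDT (h hc)) (1 / ((n : ℝ) + 1))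
      (by positivity)
    refine ⟨_, ⟨(⟨t, ht⟩, n), rfl⟩, ?_⟩
    have h1 := hf (⟨t, ht⟩, n) ⟨c, hc, hct⟩
    have h2 := dist_triangle_right c (f (⟨t, ht⟩, n)) t
    dsimp only at h1
    linarith
  have hsub : range f ⊆ C := by
    rintro _ ⟨p, rfl⟩
    exact hfC p
  calc densityChar C ≤ Cardinal.mk (range f) := densityChar_le hsub hdense
    _ ≤ Cardinal.mk (T × ℕ) := Cardinal.mk_range_le
    _ ≤ Cardinal.mk T := by
      rw [Cardinal.mk_prod]
      exact Cardinal.mul_le_of_le hTc (by simp) (by simpa using hTc)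
    _ = densityChar D := hT

end Density

lemma isTopologicalGroup_of_biinvariant {G : Type u} [Group G] [MetricSpace G]
    (hl : ∀ h g g' : G, dist (h * g) (h * g') = dist g g')
    (hr : ∀ h g g' : G, dist (g * h) (g' * h) = dist g g') : IsTopologicalGroup G where
  continuous_mul := by
    refine (LipschitzWith.of_dist_le_mul (K := 2) fun p q => ?_).continuous
    have h1 := dist_triangle (p.1 * p.2) (q.1 * p.2) (q.1 * q.2)
    rw [hl, hr] at h1
    have h2 : dist p.1 q.1 ≤ dist p q := le_max_left _ _
    have h3 : dist p.2 q.2 ≤ dist p q := le_max_right _ _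
    push_cast
    linarith
  continuous_inv := by
    refine (Isometry.of_dist_eq fun a b => ?_).continuous
    rw [← hl a, mul_inv_cancel, ← hr b, one_mul, inv_mul_cancel_right, dist_comm]

/-! ### Closed subgroups with invariant subtrees of controlled density. -/

section Hull

/-- A set of pairs of group elements and points of a real tree lies in a closed subgroup together
with a closed invariant subtree, which are not larger than the set. -/
theorem IsRTree.exists_closed_invariant {G : Type u} {X : Type v} [Group G] [MetricSpace G]
    [IsTopologicalGroup G] [MetricSpace X] [MulAction G X] [IsIsometricSMul G X]
    (hX : IsRTree X) (hcont : ∀ x : X, Continuous fun g : G => g • x) (o : X)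
    (T : Set (G ⊕ X)) (hT : T.Infinite) (a : ℕ → G) :
    ∃ (K : Subgroup G) (Y : Set X), IsClosed (K : Set G) ∧ IsClosed Y ∧ GeodConvex Y ∧ o ∈ Y ∧
      (∀ k ∈ K, ∀ y ∈ Y, k • y ∈ Y) ∧ (∀ n, a n ∈ K) ∧
      T ⊆ Sum.inl '' (K : Set G) ∪ Sum.inr '' Y ∧
      densityChar (Sum.inl '' (K : Set G) ∪ Sum.inr '' Y : Set (G ⊕ X)) ≤ Cardinal.mk T := by
  have hTc : Cardinal.aleph0 ≤ Cardinal.mk T := Cardinal.aleph0_le_mk_iff.2 hT.to_subtype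
  -- The free group indexes the generated subgroup by words, which makes cardinality easy to bound;
  -- tree points in `T` go to 1.
  let φ : FreeGroup (T ⊕ ℕ) →* G :=
    FreeGroup.lift (Sum.elim (fun t => Sum.elim id (fun _ => 1) (t : G ⊕ X)) a)
  -- `none` stands for the base point, which is also the default for group elements in `T`.
  let q : Option T → X := fun i => i.elim o fun t => Sum.elim (fun _ => o) id (t : G ⊕ X)
  let p : FreeGroup (T ⊕ ℕ) × Option T → X := fun i => φ i.1 • q i.2
  have hpath : ∀ i, ∃ f : ℝ → X, Continuous f ∧ range f = {z | Between o z (p i)} := by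
    intro i
    obtain ⟨ρ, hρ, -⟩ := hX.1 o (p i)
    refine ⟨fun t => ρ (projIcc 0 _ dist_nonneg t), hρ.1.continuous.comp continuous_projIcc, ?_⟩
    rw [setOf_between_eq_image hX.1 hρ.isGeodesicMap]
    ext z
    constructor
    · rintro ⟨t, rfl⟩
      exact ⟨projIcc 0 _ dist_nonneg t, Subtype.prop _, by simp⟩
    · rintro ⟨t, -, rfl⟩
      exact ⟨t, rfl⟩
  choose f hfc hfr using hpath
  let Z : Set X := ⋃ i, {z | Between o z (p i)}
  have hZ : GeodConvex Z := hX.geodConvex_iUnion o p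
  have hpZ : ∀ i, p i ∈ Z := fun i => mem_iUnion.2 ⟨i, between_right _ _⟩
  have hoZ : o ∈ Z := mem_iUnion.2 ⟨(1, none), between_left _ _⟩
  have hgo : ∀ w, φ w • o ∈ Z := fun w => hpZ (w, none)
  have hZinv : ∀ w, ∀ z ∈ Z, φ w • z ∈ Z := by
    intro w z hz
    obtain ⟨i, hi⟩ := mem_iUnion.1 hz
    -- The translate of `[o, p i]` does not start at `o`, but both its ends are in the convex set
    -- `Z`.
    refine hZ _ (hgo w) _ (hpZ (w * i.1, i.2)) _ ?_
    have : p (w * i.1, i.2) = φ w • p i := by simp only [p, map_mul, mul_smul]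
    rw [this]
    have hi' : dist o z + dist z (p i) = dist o (p i) := hi
    rwa [Between, dist_smul, dist_smul, dist_smul]
  have hclosure : ∀ w, ∀ y ∈ closure Z, φ w • y ∈ closure Z := by
    intro w y hy
    exact map_mem_closure (isometry_smul X (φ w)).continuous hy (hZinv w)
  -- The dense set: all words, and all segments at rational times.
  let D : Set (G ⊕ X) := range (Sum.elim (fun w => Sum.inl (φ w))
    (fun j : (FreeGroup (T ⊕ ℕ) × Option T) × ℚ => Sum.inr (f j.1 j.2)))
  have hZD : Sum.inr '' Z ⊆ closure D := by
    rintro _ ⟨z, hz, rfl⟩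
    obtain ⟨i, hi⟩ := mem_iUnion.1 hz
    rw [← hfr i] at hi
    obtain ⟨t, rfl⟩ := hi
    have ht : t ∈ closure (range ((↑) : ℚ → ℝ)) := by
      rw [Rat.denseRange_cast.closure_range]; trivial
    refine map_mem_closure (f := fun t => Sum.inr (f i t)) (by have := hfc i; fun_prop) ht ?_
    rintro _ ⟨r, rfl⟩
    exact ⟨Sum.inr (i, r), rfl⟩
  refine ⟨φ.range.topologicalClosure, closure Z, Subgroup.isClosed_topologicalClosure _,
    isClosed_closure, hZ.closure hX, subset_closure hoZ, ?_, ?_, ?_, ?_⟩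
  · intro k hk y hy
    -- Words preserve `closure Z`; continuity of the orbit map of `y` extends this to limits of
    -- words.
    have hk' : k ∈ closure (φ.range : Set G) := hk
    have := map_mem_closure (t := closure Z) (hcont y) hk' (by
      rintro _ ⟨w, rfl⟩
      exact hclosure w y hy)
    rwa [closure_closure] at this
  · intro n
    refine Subgroup.le_topologicalClosure _ ⟨FreeGroup.of (Sum.inr n), ?_⟩
    simp [φ]
  · rintro (g | x) ht
    · refine Or.inl ⟨g, Subgroup.le_topologicalClosure _
        ⟨FreeGroup.of (Sum.inl ⟨Sum.inl g, ht⟩), ?_⟩, rfl⟩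
      simp [φ]
    · refine Or.inr ⟨x, subset_closure ?_, rfl⟩
      simpa [p, q] using hpZ (1, some ⟨Sum.inr x, ht⟩)
  · refine (densityChar_le (T := D) ?_ ?_).trans ?_
    · rintro _ ⟨w | ⟨i, r⟩, rfl⟩
      · exact Or.inl ⟨φ w, Subgroup.le_topologicalClosure _ ⟨w, rfl⟩, rfl⟩
      · refine Or.inr ⟨_, subset_closure (mem_iUnion.2 ⟨i, ?_⟩), rfl⟩
        rw [← hfr i]
        exact mem_range_self _
    · apply union_subset
      · rintro _ ⟨g, hg, rfl⟩
        have hg' : g ∈ closure (φ.range : Set G) := hg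
        refine map_mem_closure continuous_inl hg' ?_
        rintro _ ⟨w, rfl⟩
        exact ⟨Sum.inl w, rfl⟩
      · exact (image_closure_subset_closure_image continuous_inr).trans
          (closure_minimal hZD isClosed_closure)
    · have hF : Cardinal.mk (FreeGroup (T ⊕ ℕ)) ≤ Cardinal.mk T := by
        rw [Cardinal.mk_freeGroup]
        refine max_le ?_ hTc
        rw [Cardinal.mk_sum]
        refine Cardinal.add_le_of_le hTc ?_ ?_
        · simp
        · simpa using hTc
      refine Cardinal.mk_range_le.trans ?_
      rw [Cardinal.mk_sum, Cardinal.lift_id, Cardinal.lift_id]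
      refine Cardinal.add_le_of_le hTc hF ?_
      rw [Cardinal.mk_prod]
      refine Cardinal.mul_le_of_le hTc ?_ ?_
      · rw [Cardinal.lift_uzero, Cardinal.mk_prod, Cardinal.lift_id, Cardinal.lift_id]
        refine Cardinal.mul_le_of_le hTc hF ?_
        rw [Cardinal.mk_option]
        exact Cardinal.add_le_of_le hTc le_rfl (Cardinal.one_le_aleph0.trans hTc)
      · simpa using hTc

end Hull

/-! ### Axioms that hold for every isometric action on a real tree. -/

section Axioms

lemma truncSub_nonneg (a b : ℝ) : 0 ≤ a ∸ b := le_max_right _ _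

lemma truncSub_eq_zero {a b : ℝ} (h : a ≤ b) : a ∸ b = 0 := max_eq_right (by linarith)

lemma truncSub_le {a b : ℝ} (ha : 0 ≤ a) (hb : 0 ≤ b) : a ∸ b ≤ a := max_le (by linarith) ha

lemma iSup_eq_zero {ι : Sort*} {f : ι → ℝ} (h : ∀ i, f i = 0) : ⨆ i, f i = 0 := by simp [h]

lemma iInf_eq_zero {ι : Sort*} {f : ι → ℝ} (h : ∀ i, 0 ≤ f i) (i : ι) (hi : f i = 0) :
    ⨅ i, f i = 0 :=
  le_antisymm (hi ▸ ciInf_le ⟨0, by rintro _ ⟨j, rfl⟩; exact h j⟩ i) (Real.iInf_nonneg h)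

/-- The bound `C` is essential: the real supremum of an unbounded family is 0 by convention. -/
lemma eq_zero_of_iSup_eq_zero {ι : Sort*} {f : ι → ℝ} (C : ℝ) (h0 : ∀ i, 0 ≤ f i)
    (hC : ∀ i, f i ≤ C) (h : ⨆ i, f i = 0) (i : ι) : f i = 0 :=
  le_antisymm (h ▸ le_ciSup ⟨C, by rintro _ ⟨j, rfl⟩; exact hC j⟩ i) (h0 i)

lemma min_eq_zero_left {a b : ℝ} (ha : a = 0) (hb : 0 ≤ b) : min a b = 0 := by
  rw [ha, min_eq_left hb]

lemma min_eq_zero_right {a b : ℝ} (ha : 0 ≤ a) (hb : b = 0) : min a b = 0 := by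
  rw [hb, min_eq_right ha]

namespace IsoStructure

variable {M : IsoStructure.{u, v}} [MulAction M.G M.X]

/-- The predicates of `M` are those of the structure `A(G, X)`. -/
def IsAction (M : IsoStructure.{u, v}) [MulAction M.G M.X] : Prop :=
  ∀ m n : ℕ, m < n → ∀ (g : M.G) (x y : M.B m),
    M.circ m n g x y = segLength (g • (x : M.X)) (y : M.X) (M.B n)

lemma IsAction.circ_nonneg (h : M.IsAction) {m n : ℕ} (hmn : m < n) (g : M.G) (x y : M.B m) :
    0 ≤ M.circ m n g x y := by
  rw [h m n hmn]; exact segLength_nonneg _ _ _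

lemma IsAction.circ_eq_dist (h : M.IsAction) (hX : IsRTree M.X) {m n : ℕ} (hmn : m < n)
    {g : M.G} {x : M.B m} (hg : g • (x : M.X) ∈ M.B m) (y : M.B m) :
    M.circ m n g x y = dist (g • (x : M.X)) y := by
  have hsub : M.B m ⊆ M.B n := Metric.closedBall_subset_closedBall (Nat.cast_le.2 hmn.le)
  rw [h m n hmn]
  exact segLength_eq_dist hX (hsub hg) (hsub y.2)

/-- The final part of `[gx, 0]` of length `min (d(gx, 0)) n` lies in `B n`. If the length seen is
below `m < n`, this part is the whole segment, so `gx ∈ B m`, and convexity of balls makes all the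
values distances. -/
lemma IsAction.truncSub_eq_zero_or (h : M.IsAction) (hX : IsRTree M.X) {m n : ℕ} (hmn : m < n)
    (g : M.G) (x : M.B m) :
    (m : ℝ) ∸ M.circ m n g x (M.zero m) = 0 ∨
      g • (x : M.X) ∈ M.B m ∧ ∀ y, M.circ m n g x y = dist (g • (x : M.X)) y := by
  rcases le_or_gt (m : ℝ) (M.circ m n g x (M.zero m)) with hle | hlt
  · exact Or.inl (truncSub_eq_zero hle)
  · right
    have hmn' : (m : ℝ) < n := Nat.cast_lt.2 hmn
    have hg : g • (x : M.X) ∈ M.B m := by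
      have h1 := min_le_segLength hX.1 (x := g • (x : M.X)) (y := M.base) (o := M.base) (a := 0)
        (b := n) (r := n) (Nat.cast_nonneg n) (by simp) (by simp)
      rw [h m n hmn] at hlt
      rw [Metric.mem_closedBall]
      rcases min_le_iff.1 (h1.trans hlt.le) with h2 | h2
      · exact h2
      · exact absurd h2 (by linarith)
    exact ⟨hg, fun y => h.circ_eq_dist hX hmn hg y⟩

/-- The orbit maps of the action are continuous, since the predicates have moduli. -/
lemma IsAction.continuous_smul [IsIsometricSMul M.G M.X] (h : M.IsAction) (hX : IsRTree M.X)
    (hl : ∀ h g g' : M.G, dist (h * g) (h * g') = dist g g') {γ : ℕ → ℕ → ℝ → ℝ}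
    (hγ : ∀ m n : ℕ, m < n → ∀ x y : M.B m,
      HasModulus (γ m n) (fun g : M.G => M.circ m n g x y)) (x : M.X) :
    Continuous fun g : M.G => g • x := by
  obtain ⟨m, hm⟩ := exists_nat_ge (dist x M.base)
  let x' : M.B m := ⟨x, hm⟩
  have hmn := Nat.lt_succ_self m
  rw [Metric.continuous_iff]
  intro g ε hε
  -- `B (m + 1)` shows only the last unit of `[gx, x]` for certain; a length below 1 is then an
  -- upper bound for the distance.
  have hε' : 0 < min ε 1 := lt_min hε one_pos
  obtain ⟨hpos, hmod⟩ := hγ m (m + 1) hmn x' x'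
  refine ⟨_, hpos _ hε', fun g' hg' => ?_⟩
  have h1 := hmod _ hε' (g⁻¹ * g') 1 (by
    rw [← hl g, mul_inv_cancel_left, mul_one]; exact hg')
  dsimp only at h1
  have h2 : M.circ m (m + 1) 1 x' x' = 0 := by
    rw [h.circ_eq_dist hX hmn (by rw [one_smul]; exact x'.2), one_smul, dist_self]
  rw [h2, sub_zero, abs_of_nonneg (h.circ_nonneg hmn _ _ _), h _ _ hmn] at h1
  have h3 := min_le_segLength hX.1 (x := (g⁻¹ * g') • x) (y := x) (o := M.base) (a := m)
    (b := 1) (r := (m + 1 : ℕ)) zero_le_one hm (by push_cast; rfl)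
  have h4 : dist ((g⁻¹ * g') • x) x = dist (g' • x) (g • x) := by
    rw [← dist_smul g, mul_smul, smul_inv_smul]
  rw [h4] at h3
  have h5 := h3.trans_lt h1
  rcases le_total (dist (g' • x) (g • x)) 1 with h6 | h6
  · rw [min_eq_left h6] at h5
    exact h5.trans_le (min_le_left _ _)
  · rw [min_eq_right h6] at h5
    exact absurd h5 (not_lt.2 (min_le_right _ _))

/-- For an isometric action on a real tree, only the range, the moduli and the axioms involving
the growth function have to be checked. -/
theorem IsAction.kIsoR [IsIsometricSMul M.G M.X] (h : M.IsAction) (hX : IsRTree M.X)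
    {gth : ℕ → Ico (0 : ℝ) 1 → ℕ} {γ : ℕ → ℕ → ℝ → ℝ}
    (completeG : CompleteSpace M.G) (boundedSpace : BoundedSpace M.G)
    (dist_mul_left : ∀ h g g' : M.G, dist (h * g) (h * g') = dist g g')
    (dist_mul_right : ∀ h g g' : M.G, dist (g * h) (g' * h) = dist g g')
    (completeX : CompleteSpace M.X)
    (circ_mem : ∀ m n : ℕ, m < n → ∀ (g : M.G) (x y : M.B m),
      M.circ m n g x y ∈ Icc (0 : ℝ) ((m : ℝ) + n))
    (modulus_G : ∀ m n : ℕ, m < n → ∀ x y : M.B m,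
      HasModulus (γ m n) (fun g : M.G => M.circ m n g x y))
    (modulus_left : ∀ m n : ℕ, m < n → ∀ (g : M.G) (y : M.B m),
      HasModulus id (fun x : M.B m => M.circ m n g x y))
    (modulus_right : ∀ m n : ℕ, m < n → ∀ (g : M.G) (x : M.B m),
      HasModulus id (fun y : M.B m => M.circ m n g x y))
    (ax1a : ∀ (m n s : ℕ) (δ : ℚ) (hδ : (δ : ℝ) ∈ Ico (0 : ℝ) 1), m < s →
      gth m ⟨δ, hδ⟩ ≤ n → n < s → ∀ (g : M.G) (x : M.B m),
        min (M.circ m s g x (M.zero m) ∸ n) ((δ : ℝ) ∸ dist 1 g) = 0)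
    (ax1b : ∀ (m m' s t : ℕ) (δ : ℚ) (hδ : (δ : ℝ) ∈ Ico (0 : ℝ) 1) (hm : m < m'),
      m < s → m' < t → gth m ⟨δ, hδ⟩ < s → s < t → gth m' ⟨δ, hδ⟩ < t →
      ∀ (g : M.G) (x y : M.B m),
        min |M.circ m s g x y - M.circ m' t g (M.incl hm.le x) (M.incl hm.le y)|
          ((δ : ℝ) ∸ dist 1 g) = 0) :
    KIsoR gth γ M where
  completeG := completeG
  boundedSpace := boundedSpace
  dist_mul_left := dist_mul_left
  dist_mul_right := dist_mul_right
  completeX := completeX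
  isRTree := hX
  circ_mem := circ_mem
  modulus_G := modulus_G
  modulus_left := modulus_left
  modulus_right := modulus_right
  ax1a m n s δ hδ h1 h2 h3 := iSup_eq_zero fun g => iSup_eq_zero fun x =>
    ax1a m n s δ hδ h1 h2 h3 g x
  ax1b m m' s t δ hδ hm h1 h2 h3 h4 h5 := iSup_eq_zero fun g => iSup_eq_zero fun x =>
    iSup_eq_zero fun y => ax1b m m' s t δ hδ hm h1 h2 h3 h4 h5 g x y
  ax1c m n hmn := by
    refine iSup_eq_zero fun g => iSup_eq_zero fun x => ?_
    have hnn : ∀ z : M.B m, 0 ≤ max (M.circ m n g x z)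
        (⨆ w : M.B m, min |dist w z - M.circ m n g x w| ((m : ℝ) ∸ dist (M.zero m) w)) :=
      fun z => le_max_of_le_left (h.circ_nonneg hmn _ _ _)
    rcases h.truncSub_eq_zero_or hX hmn g x with h0 | ⟨hg, hc⟩
    · exact min_eq_zero_left h0 (Real.iInf_nonneg hnn)
    -- The infimum is attained at `gx` itself.
    · refine min_eq_zero_right (truncSub_nonneg _ _) (iInf_eq_zero hnn ⟨_, hg⟩ ?_)
      rw [hc, dist_self]
      refine max_eq_left (le_of_eq (iSup_eq_zero fun w => ?_))
      refine min_eq_zero_left ?_ (truncSub_nonneg _ _)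
      rw [hc, Subtype.dist_eq, dist_comm, sub_self, abs_zero]
  ax2a m n hmn := by
    refine iSup_eq_zero fun g => iSup_eq_zero fun x => iSup_eq_zero fun y₁ =>
      iSup_eq_zero fun y₂ => ?_
    rcases h.truncSub_eq_zero_or hX hmn g x with h0 | ⟨-, hc⟩
    · exact min_eq_zero_right (truncSub_nonneg _ _) h0
    · refine min_eq_zero_left (truncSub_eq_zero ?_) (truncSub_nonneg _ _)
      rw [hc, hc, Subtype.dist_eq]
      exact dist_triangle_left _ _ _
  ax2a' m n hmn := by
    refine iSup_eq_zero fun g => iSup_eq_zero fun x => iSup_eq_zero fun y₁ =>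
      iSup_eq_zero fun y₂ => ?_
    rcases h.truncSub_eq_zero_or hX hmn g x with h0 | ⟨-, hc⟩
    · exact min_eq_zero_right (truncSub_nonneg _ _) h0
    · refine min_eq_zero_left (truncSub_eq_zero ?_) (truncSub_nonneg _ _)
      rw [hc, hc, Subtype.dist_eq, add_comm, dist_comm (y₁ : M.X)]
      exact dist_triangle _ _ _
  ax2b m n hmn := by
    refine iSup_eq_zero fun g => iSup_eq_zero fun x₁ => iSup_eq_zero fun x₂ => ?_
    have hs : 0 ≤ ⨆ y : M.B m, dist x₁ x₂ ∸ (M.circ m n g x₁ y + M.circ m n g x₂ y) :=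
      Real.iSup_nonneg fun y => truncSub_nonneg _ _
    rcases h.truncSub_eq_zero_or hX hmn g x₁ with h0 | ⟨-, hc⟩
    · exact min_eq_zero_right hs (min_eq_zero_left h0 (truncSub_nonneg _ _))
    rcases h.truncSub_eq_zero_or hX hmn g x₂ with h0 | ⟨-, hc'⟩
    · exact min_eq_zero_right hs (min_eq_zero_right (truncSub_nonneg _ _) h0)
    refine min_eq_zero_left (iSup_eq_zero fun y => truncSub_eq_zero ?_)
      (le_min (truncSub_nonneg _ _) (truncSub_nonneg _ _))
    rw [hc, hc', Subtype.dist_eq, ← dist_smul g]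
    exact dist_triangle_right _ _ _
  ax2c m n hmn := by
    refine iSup_eq_zero fun g => iSup_eq_zero fun x₁ => iSup_eq_zero fun x₂ => ?_
    have hs : 0 ≤ ⨅ y : M.B m, (M.circ m n g x₁ y + M.circ m n g x₂ y) ∸ dist x₁ x₂ :=
      Real.iInf_nonneg fun y => truncSub_nonneg _ _
    rcases h.truncSub_eq_zero_or hX hmn g x₁ with h0 | ⟨hg, hc⟩
    · exact min_eq_zero_right hs (min_eq_zero_left h0 (truncSub_nonneg _ _))
    rcases h.truncSub_eq_zero_or hX hmn g x₂ with h0 | ⟨-, hc'⟩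
    · exact min_eq_zero_right hs (min_eq_zero_right (truncSub_nonneg _ _) h0)
    refine min_eq_zero_left (iInf_eq_zero (fun y => truncSub_nonneg _ _) ⟨_, hg⟩
      (truncSub_eq_zero ?_)) (le_min (truncSub_nonneg _ _) (truncSub_nonneg _ _))
    rw [hc, hc', Subtype.dist_eq, dist_self, zero_add, dist_smul, dist_comm]
  ax3a m n hmn := by
    refine iSup_eq_zero fun x => iSup_eq_zero fun y => ?_
    rw [h.circ_eq_dist hX hmn (by rw [one_smul]; exact x.2), one_smul, Subtype.dist_eq, sub_self,
      abs_zero]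
  ax3b m n hmn := by
    refine iSup_eq_zero fun g => iSup_eq_zero fun x => iSup_eq_zero fun y => ?_
    rcases h.truncSub_eq_zero_or hX hmn g x with h0 | ⟨-, hc⟩
    · exact min_eq_zero_right (abs_nonneg _) (min_eq_zero_left h0 (truncSub_nonneg _ _))
    rcases h.truncSub_eq_zero_or hX hmn g⁻¹ y with h0 | ⟨-, hc'⟩
    · exact min_eq_zero_right (abs_nonneg _) (min_eq_zero_right (truncSub_nonneg _ _) h0)
    refine min_eq_zero_left ?_ (le_min (truncSub_nonneg _ _) (truncSub_nonneg _ _))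
    rw [hc, hc', ← dist_smul g⁻¹, inv_smul_smul, dist_comm, sub_self, abs_zero]
  ax3c m n hmn := by
    refine iSup_eq_zero fun x => iSup_eq_zero fun y => iSup_eq_zero fun g =>
      iSup_eq_zero fun g' => ?_
    have hs : 0 ≤ ⨆ z : M.B m, M.circ m n (g * g') x y ∸
        (M.circ m n g⁻¹ y z + M.circ m n g' x z) :=
      Real.iSup_nonneg fun y => truncSub_nonneg _ _
    have ht := truncSub_nonneg
    rcases h.truncSub_eq_zero_or hX hmn g⁻¹ y with h0 | ⟨-, hc⟩
    · exact min_eq_zero_right hs (min_eq_zero_left h0 (le_min (ht _ _) (ht _ _)))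
    rcases h.truncSub_eq_zero_or hX hmn g' x with h0 | ⟨-, hc'⟩
    · exact min_eq_zero_right hs (min_eq_zero_right (ht _ _) (min_eq_zero_left h0 (ht _ _)))
    rcases h.truncSub_eq_zero_or hX hmn (g * g') x with h0 | ⟨-, hc''⟩
    · exact min_eq_zero_right hs (min_eq_zero_right (ht _ _) (min_eq_zero_right (ht _ _) h0))
    refine min_eq_zero_left (iSup_eq_zero fun z => truncSub_eq_zero ?_)
      (le_min (ht _ _) (le_min (ht _ _) (ht _ _)))
    rw [hc, hc', hc'', ← dist_smul g⁻¹ _ (y : M.X), mul_smul, inv_smul_smul, add_comm]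
    exact dist_triangle_right _ _ _

end IsoStructure

end Axioms

/-! ### Inherited conditions, bountifulness and the displacement bound. -/

section Main

variable {gth : ℕ → Ico (0 : ℝ) 1 → ℕ} {γ : ℕ → ℕ → ℝ → ℝ}

/-- The pointwise form passes to substructures. The guard is at most `δ`, which supplies the bound
for unwinding the suprema. -/
lemma KIsoR.growth {M : IsoStructure.{u, v}} (h : KIsoR gth γ M) (m n s : ℕ) (δ : ℚ)
    (hδ : (δ : ℝ) ∈ Ico (0 : ℝ) 1) (h1 : m < s) (h2 : gth m ⟨δ, hδ⟩ ≤ n) (h3 : n < s) (g : M.G)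
    (x : M.B m) : min (M.circ m s g x (M.zero m) ∸ n) ((δ : ℝ) ∸ dist 1 g) = 0 := by
  have h0 : ∀ (g : M.G) (x : M.B m),
      0 ≤ min (M.circ m s g x (M.zero m) ∸ n) ((δ : ℝ) ∸ dist 1 g) := fun g x =>
    le_min (truncSub_nonneg _ _) (truncSub_nonneg _ _)
  have hC : ∀ (g : M.G) (x : M.B m),
      min (M.circ m s g x (M.zero m) ∸ n) ((δ : ℝ) ∸ dist 1 g) ≤ δ := fun g x =>
    (min_le_right _ _).trans (truncSub_le hδ.1 dist_nonneg)
  exact eq_zero_of_iSup_eq_zero δ (h0 g) (hC g)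
    (eq_zero_of_iSup_eq_zero δ (fun g => Real.iSup_nonneg (h0 g))
      (fun g => Real.iSup_le (hC g) hδ.1) (h.ax1a m n s δ hδ h1 h2 h3) g) x

lemma KIsoR.correct {M : IsoStructure.{u, v}} (h : KIsoR gth γ M) (m m' s t : ℕ) (δ : ℚ)
    (hδ : (δ : ℝ) ∈ Ico (0 : ℝ) 1) (hm : m < m') (h1 : m < s) (h2 : m' < t)
    (h3 : gth m ⟨δ, hδ⟩ < s) (h4 : s < t) (h5 : gth m' ⟨δ, hδ⟩ < t) (g : M.G) (x y : M.B m) :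
    min |M.circ m s g x y - M.circ m' t g (M.incl hm.le x) (M.incl hm.le y)|
      ((δ : ℝ) ∸ dist 1 g) = 0 := by
  have h0 : ∀ (g : M.G) (x y : M.B m),
      0 ≤ min |M.circ m s g x y - M.circ m' t g (M.incl hm.le x) (M.incl hm.le y)|
        ((δ : ℝ) ∸ dist 1 g) := fun g x y => le_min (abs_nonneg _) (truncSub_nonneg _ _)
  have hC : ∀ (g : M.G) (x y : M.B m),
      min |M.circ m s g x y - M.circ m' t g (M.incl hm.le x) (M.incl hm.le y)|
        ((δ : ℝ) ∸ dist 1 g) ≤ δ := fun g x y =>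
    (min_le_right _ _).trans (truncSub_le hδ.1 dist_nonneg)
  have e := eq_zero_of_iSup_eq_zero δ
    (fun g => Real.iSup_nonneg fun x => Real.iSup_nonneg (h0 g x))
    (fun g => Real.iSup_le (fun x => Real.iSup_le (hC g x) hδ.1) hδ.1)
    (h.ax1b m m' s t δ hδ hm h1 h2 h3 h4 h5) g
  have e' := eq_zero_of_iSup_eq_zero δ (fun x => Real.iSup_nonneg (h0 g x))
    (fun x => Real.iSup_le (hC g x) hδ.1) e x
  exact eq_zero_of_iSup_eq_zero δ (h0 g x) (hC g x) e' y

lemma HasModulus.comp {A B : Type*} [MetricSpace A] [MetricSpace B] {η : ℝ → ℝ} {R : B → ℝ}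
    (h : HasModulus η R) {f : A → B} (hf : Isometry f) : HasModulus η (fun a => R (f a)) :=
  ⟨h.1, fun ε hε a a' haa => h.2 ε hε _ _ (by rwa [hf.dist_eq])⟩

open IsoStructure in
/-- A closed subgroup and a closed invariant subtree form a structure in the class. -/
theorem WitnessesNonFR.restrict {M : IsoStructure.{u, v}} [MulAction M.G M.X]
    [IsIsometricSMul M.G M.X] (hA : M.IsAction) (hM : KIsoR gth γ M) {K : Subgroup M.G}
    {Y : Set M.X} (hY : M.base ∈ Y) (hK : IsClosed (K : Set M.G)) (hYc : IsClosed Y)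
    (hYconv : GeodConvex Y) (hinv : ∀ k ∈ K, ∀ y ∈ Y, k • y ∈ Y)
    (hfix : ∀ y ∈ Y, ∃ k ∈ K, k • y ≠ y) :
    WitnessesNonFR gth γ (M.restrict K Y hY) := by
  let act : MulAction (M.restrict K Y hY).G (M.restrict K Y hY).X :=
    { smul := fun k y => ⟨(k : K).1 • (y : Y).1, hinv _ (k : K).2 _ (y : Y).2⟩
      one_smul := fun y => Subtype.ext (one_smul M.G (y : Y).1)
      mul_smul := fun k k' y => Subtype.ext (mul_smul (k : K).1 (k' : K).1 (y : Y).1) }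
  have iso : IsIsometricSMul (M.restrict K Y hY).G (M.restrict K Y hY).X :=
    ⟨fun k => Isometry.of_dist_eq fun y y' => dist_smul (k : K).1 (y : Y).1 (y' : Y).1⟩
  have hA' : (M.restrict K Y hY).IsAction := by
    intro m n hmn g x y
    refine (hA m n hmn _ _ _).trans ?_
    exact (hYconv.segLength_coe hM.isRTree.1 (g • x.1 : (M.restrict K Y hY).X) y.1 (M.B n)).symm
  have := hM.boundedSpace
  have := hM.completeG
  have := hM.completeX
  let emb : ∀ m, (M.restrict K Y hY).B m → M.B m := fun m x => ⟨(x.1 : Y).1, x.2⟩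
  have hemb : ∀ m, Isometry (emb m) := fun m => Isometry.of_dist_eq fun _ _ => rfl
  refine ⟨act, iso, ?_, hA', hA'.kIsoR (hYconv.isRTree hM.isRTree) ?_ ?_ ?_ ?_ ?_ ?_ ?_ ?_ ?_
    ?_ ?_⟩
  · intro y
    obtain ⟨k, hk, hne⟩ := hfix (y : Y).1 (y : Y).2
    exact ⟨(⟨k, hk⟩ : K), fun he => hne (congrArg (Subtype.val : Y → M.X) he)⟩
  · exact hK.completeSpace_coe
  · exact inferInstanceAs (BoundedSpace K)
  · exact fun h g g' => hM.dist_mul_left (h : K).1 (g : K).1 (g' : K).1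
  · exact fun h g g' => hM.dist_mul_right (h : K).1 (g : K).1 (g' : K).1
  · exact hYc.completeSpace_coe
  · exact fun m n hmn g x y => hM.circ_mem m n hmn (g : K).1 (emb m x) (emb m y)
  · exact fun m n hmn x y =>
      (hM.modulus_G m n hmn (emb m x) (emb m y)).comp (f := (Subtype.val : K → M.G))
        isometry_subtype_coe
  · exact fun m n hmn g y => (hM.modulus_left m n hmn (g : K).1 (emb m y)).comp (hemb m)
  · exact fun m n hmn g x => (hM.modulus_right m n hmn (g : K).1 (emb m x)).comp (hemb m)
  · exact fun m n s δ hδ h1 h2 h3 g x =>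
      hM.growth m n s δ hδ h1 h2 h3 (g : K).1 (emb m x)
  · exact fun m m' s t δ hδ hm h1 h2 h3 h4 h5 g x y =>
      hM.correct m m' s t δ hδ hm h1 h2 h3 h4 h5 (g : K).1 (emb m x) (emb m y)

theorem bountiful_witnessesNonFR (gth : ℕ → Ico (0 : ℝ) 1 → ℕ) (γ : ℕ → ℕ → ℝ → ℝ) :
    Bountiful.{u, v} (WitnessesNonFR.{u, v} gth γ) := by
  rintro M ⟨act, iso, hfix, hA, hM⟩ C hC
  have := hM.completeX
  have := hM.completeG
  have hX := hM.isRTree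
  have := isTopologicalGroup_of_biinvariant hM.dist_mul_left hM.dist_mul_right
  have hcont := IsoStructure.IsAction.continuous_smul hA hX hM.dist_mul_left hM.modulus_G
  -- Countably many elements suffice to make the orbit of the base point unbounded.
  choose a ha using fun n : ℕ => hX.exists_lt_dist_smul hfix M.base n
  obtain ⟨T, hTC, hCT, hTcard⟩ := exists_mk_eq_densityChar C
  obtain ⟨K, Y, hK, hYc, hYconv, hY, hinv, haK, hTKY, hd⟩ :=
    hX.exists_closed_invariant hcont M.base T (hC.of_subset_closure hCT) a
  have hsub : C ⊆ Sum.inl '' (K : Set M.G) ∪ Sum.inr '' Y :=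
    hCT.trans (closure_minimal hTKY
      ((Topology.IsClosedEmbedding.inl.isClosedMap _ hK).union
        (Topology.IsClosedEmbedding.inr.isClosedMap _ hYc)))
  refine ⟨K, Y, hY, hsub, WitnessesNonFR.restrict hA hM hY hK hYc hYconv hinv ?_,
    le_antisymm (hTcard ▸ hd) (densityChar_mono hC hsub)⟩
  intro y _
  by_contra! hall
  -- A point `y` fixed by `K` would keep the `K`-orbit of the base point within `2 d(y, 0)` of it.
  obtain ⟨n, hn⟩ := exists_nat_ge (2 * dist y M.base)
  have h1 := ha n
  have h2 := dist_triangle (a n • M.base) (a n • y) M.base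
  rw [dist_smul, hall _ (haK n), dist_comm M.base] at h2
  linarith

theorem theta_one_ofAction {G : Type u} [Group G] [MetricSpace G] {X : Type v} [MetricSpace X]
    [CompleteSpace X] [MulAction G X] [IsIsometricSMul G X] (hX : IsRTree X)
    (hfix : ∀ x : X, ∃ g : G, g • x ≠ x) (o : X) {m n : ℕ} (hmn : m < n) :
    Theta 1 m n (IsoStructure.ofAction G X o) := by
  refine iSup_eq_zero fun w => ?_
  let p : X := w.1
  obtain ⟨g, hg⟩ := hX.exists_lt_dist_smul hfix p 1
  refine iInf_eq_zero (fun g => truncSub_nonneg _ _) g (truncSub_eq_zero ?_)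
  -- The gap of one between `m` and `n` is what makes `s = 1` work uniformly.
  have h1 : (m : ℝ) + 1 ≤ n := by exact_mod_cast hmn
  have h2 := min_le_segLength hX.1 (x := g • p) (y := p) (o := o) zero_le_one w.2 h1
  rw [min_eq_right hg.le] at h2
  rw [Nat.cast_one, div_one]
  exact h2

end Main

theorem theorem3p10 (gth : ℕ → Set.Ico (0 : ℝ) 1 → ℕ)
    (hgth : ∀ δ : Set.Ico (0 : ℝ) 1, Monotone (fun m : ℕ => gth m δ))
    (γ : ℕ → ℕ → ℝ → ℝ) :
    (∃ s : ℕ, 0 < s ∧ ∀ (G : Type u) [Group G] [MetricSpace G],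
      HasNonFR.{u, v} gth γ G →
        ∃ (X : Type v) (_ : MetricSpace X) (_ : MulAction G X) (o : X),
          IsIsometricSMul G X ∧ KIsoR gth γ (IsoStructure.ofAction G X o) ∧
            ∀ m n : ℕ, m < n → Theta s m n (IsoStructure.ofAction G X o)) ∧
    Bountiful.{u, v} (WitnessesNonFR.{u, v} gth γ) := by
  refine ⟨⟨1, one_pos, ?_⟩, bountiful_witnessesNonFR gth γ⟩
  rintro G _ _ ⟨X, _, _, o, hiso, hfix, hK⟩
  have : CompleteSpace X := hK.completeX
  have hX : IsRTree X := hK.isRTree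
  exact ⟨X, inferInstance, inferInstance, o, hiso, hK, fun m n hmn =>
    theta_one_ofAction hX hfix o hmn⟩
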